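/- Consider maximizing $f(S)$ subject to $c(S)\le K$ over $S\subseteq E$, where $E$ is a finite non-empty ground set of $n=|E|$ items, $f:2^E\to\mathbb{R}_{\ge 0}$ is a monotone submodular set function given by a value oracle, $c:E\to\{1,2,\dots\}$ assigns a size to each item, $c(S)=\sum_{e\in S}c(e)$, $K\ge 1$ is an integer, and $c(e)\le K$ for every $e\in E$. The items arrive one after the other in an arbitrary order; in each pass the algorithm reads this stream once. An item can be used only while it is being read or if it is stored in memory, and the oracle can be called only for a stored set of items, possibly together with the item being read. Space is the number of memory words (stored items, numbers and indices). Time is the number of elementary steps of a random access machine with real arithmetic, where an oracle call takes one step. Theorem. There are one (deterministic) algorithm, which receives $\varepsilon$ and $K$ as input, and one absolute constant $C$ such that for all $\varepsilon\in(0,1/2]$, every $K\ge 1$, every such instance and every order of arrival, the algorithm halts with a set $S\subseteq E$ such that $c(S)\le K$ and $$f(S)\ \ge\ (0.5-\varepsilon)\,\max\{f(T) : T\subseteq E,\ c(T)\le K\},$$ and it uses at most $C\,K\varepsilon^{-7}\log^2(K+1)$ space, at most $C\,\varepsilon^{-1}$ passes over the stream, and at most $C\,n\,\varepsilon^{-8}\log^2(K+1)$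 time. -/

import Mathlib

/-- A set function on the subsets of `E` is submodular if it has diminishing marginal returns. -/
def IsSubmodular {E : Type*} [DecidableEq E] (f : Finset E → ℝ) : Prop :=
  ∀ S T : Finset E, S ⊆ T → ∀ e, e ∉ T →
    f (insert e T) - f T ≤ f (insert e S) - f S

/-- The total size `c(S)` of a set of items. -/
def totalSize {E : Type*} (c : E → ℕ) (S : Finset E) : ℕ := ∑ e ∈ S, c e

/-!
A multi-pass streaming random access machine with real arithmetic and a value oracle.

Items are opaque: an item can only be read from the stream, be put into one of the stored sets, and
be passed to the oracle. The memory consists of index variables (natural numbers, used for control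
and for addressing), number cells (reals) and set registers (sets of stored items), all of them
addressed by natural numbers. A program is a fixed finite text, which does not depend on the input.
-/
namespace StreamRAM

/-- Index expressions; `var x` is the content of the index variable `x`. -/
inductive IExp : Type
  | const (n : ℕ)
  | var (x : ℕ)
  | add (a b : IExp)

/-- Real expressions. `ofIdx a` is an index expression read as a real number, `cell a` is the
content of the number cell with address `a`, and `itemSize` is the size of the item of the stream
that is currently being read. -/
inductive RExp : Type
  | ofIdx (a : IExp)
  | cell (a : IExp)
  | itemSize
  | add (x y : RExp)
  | sub (x y : RExp)
  | mul (x y : RExp)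
  | div (x y : RExp)

/-- Tests. -/
inductive Test : Type
  | leIdx (a b : IExp)
  | leNum (x y : RExp)
  | not (b : Test)

/-- Programs. Addresses of number cells and of set registers are index expressions, so that
addressing is indirect. -/
inductive Prog : Type
  | skip
  /-- index variable `x` := `a` -/
  | setIdx (x : ℕ) (a : IExp)
  /-- number cell `a` := `x` -/
  | setNum (a : IExp) (x : RExp)
  /-- number cell `a` := `f(S)`, where `S` is the content of the set register `s` -/
  | query (a s : IExp)
  /-- number cell `a` := `f(S + e)`, where `S` is the content of the set register `s`, and `e` is
  the item currently being read -/
  | queryAdd (a s : IExp)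
  /-- set register `s` := `∅` -/
  | clear (s : IExp)
  /-- add the item currently being read to the set register `s` -/
  | insert (s : IExp)
  /-- add all items of the set register `s'` to the set register `s` -/
  | union (s s' : IExp)
  | seq (p q : Prog)
  | ite (b : Test) (p q : Prog)
  | while (b : Test) (p : Prog)
  /-- one pass over the stream: run `p` once for every item, in the order of arrival -/
  | pass (p : Prog)

/-- The content of the memory. -/
structure State (E : Type*) where
  idx : ℕ → ℕ
  num : ℕ → ℝ
  reg : ℕ → Finset E

/-- What is accessible of the stream: nothing (outside of the passes), one item `e` (when it is
being processed during a pass), or (between two items of a pass) the list of items which have yet to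
arrive in this pass. -/
inductive Phase (E : Type*) : Type _
  | idle
  | item (e : E)
  | reading (l : List E)

/-- The memory at the start: the number cells `0` and `1` hold the two input parameters, everything
else is empty. -/
noncomputable def State.init (E : Type*) (ε : ℝ) (K : ℕ) : State E where
  idx := fun _ => 0
  num := fun a => if a = 0 then ε else if a = 1 then (K : ℝ) else 0
  reg := fun _ => ∅

/-- The number of stored items in the set registers with address below `m`, with multiplicity. -/
def State.stored {E : Type*} (σ : State E) (m : ℕ) : ℕ := ∑ j ∈ Finset.range m, (σ.reg j).card

def State.setIdx {E : Type*} (σ : State E) (x v : ℕ) : State E :=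
  { σ with idx := Function.update σ.idx x v }

noncomputable def State.setNum {E : Type*} (σ : State E) (a : ℕ) (r : ℝ) : State E :=
  { σ with num := Function.update σ.num a r }

def State.setReg {E : Type*} (σ : State E) (s : ℕ) (S : Finset E) : State E :=
  { σ with reg := Function.update σ.reg s S }

def IExp.eval {E : Type*} (σ : State E) : IExp → ℕ
  | .const n => n
  | .var x => σ.idx x
  | .add a b => a.eval σ + b.eval σ

/-- The size of the item being read (and `0` if there is none). -/
noncomputable def Phase.size {E : Type*} (c : E → ℕ) : Phase E → ℝ
  | .item e => (c e : ℝ)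
  | _ => 0

noncomputable def RExp.eval {E : Type*} (c : E → ℕ) (ph : Phase E) (σ : State E) : RExp → ℝ
  | .ofIdx a => (a.eval σ : ℝ)
  | .cell a => σ.num (a.eval σ)
  | .itemSize => ph.size c
  | .add x y => x.eval c ph σ + y.eval c ph σ
  | .sub x y => x.eval c ph σ - y.eval c ph σ
  | .mul x y => x.eval c ph σ * y.eval c ph σ
  | .div x y => x.eval c ph σ / y.eval c ph σ

def Test.holds {E : Type*} (c : E → ℕ) (ph : Phase E) (σ : State E) : Test → Prop
  | .leIdx a b => a.eval σ ≤ b.eval σ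
  | .leNum x y => x.eval c ph σ ≤ y.eval c ph σ
  | .not b => ¬ b.holds c ph σ

/-- `Exec f c stream m p ph σ σ' t k`: in a memory of size `m`, with value oracle `f` and item sizes
`c`, the program `p` started from `σ` halts in `σ'` after `t` steps and `k` passes over `stream`.

Memory of size `m` means that there are `m` index variables with values at most `m`, `m` number
cells, and `m` set registers, which hold at most `m` items altogether. A write that would violate
this has no rule: the execution gets stuck. (A cell with address `≥ m` is therefore never changed.)
Every elementary operation, every oracle call, every test and every arrival of an item takes one
step; `union` takes one more step for every item that it copies. Passes cannot be nested. -/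
inductive Exec {E : Type*} [DecidableEq E] (f : Finset E → ℝ) (c : E → ℕ) (stream : List E)
    (m : ℕ) : Prog → Phase E → State E → State E → ℕ → ℕ → Prop
  | skip (ph σ) : Exec f c stream m .skip ph σ σ 1 0
  | setIdx (ph σ x a) (hx : x < m) (hv : a.eval σ ≤ m) :
      Exec f c stream m (.setIdx x a) ph σ (σ.setIdx x (a.eval σ)) 1 0
  | setNum (ph σ a x) (ha : a.eval σ < m) :
      Exec f c stream m (.setNum a x) ph σ (σ.setNum (a.eval σ) (x.eval c ph σ)) 1 0
  | query (ph σ a s) (ha : a.eval σ < m) :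
      Exec f c stream m (.query a s) ph σ (σ.setNum (a.eval σ) (f (σ.reg (s.eval σ)))) 1 0
  | queryAdd (e σ a s) (ha : a.eval σ < m) :
      Exec f c stream m (.queryAdd a s) (.item e) σ
        (σ.setNum (a.eval σ) (f (insert e (σ.reg (s.eval σ))))) 1 0
  | clear (ph σ s) (hs : s.eval σ < m) :
      Exec f c stream m (.clear s) ph σ (σ.setReg (s.eval σ) ∅) 1 0
  | insert (e σ s) (hs : s.eval σ < m)
      (hm : (σ.setReg (s.eval σ) (insert e (σ.reg (s.eval σ)))).stored m ≤ m) :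
      Exec f c stream m (.insert s) (.item e) σ
        (σ.setReg (s.eval σ) (insert e (σ.reg (s.eval σ)))) 1 0
  | union (ph σ s s') (hs : s.eval σ < m)
      (hm : (σ.setReg (s.eval σ) (σ.reg (s.eval σ) ∪ σ.reg (s'.eval σ))).stored m ≤ m) :
      Exec f c stream m (.union s s') ph σ
        (σ.setReg (s.eval σ) (σ.reg (s.eval σ) ∪ σ.reg (s'.eval σ)))
        (1 + (σ.reg (s'.eval σ)).card) 0
  | seq {p q ph σ σ₁ σ₂ t₁ t₂ k₁ k₂} (hp : Exec f c stream m p ph σ σ₁ t₁ k₁)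
      (hq : Exec f c stream m q ph σ₁ σ₂ t₂ k₂) :
      Exec f c stream m (.seq p q) ph σ σ₂ (t₁ + t₂) (k₁ + k₂)
  | ite_true {b p q ph σ σ₁ t k} (hb : b.holds c ph σ) (hp : Exec f c stream m p ph σ σ₁ t k) :
      Exec f c stream m (.ite b p q) ph σ σ₁ (1 + t) k
  | ite_false {b p q ph σ σ₁ t k} (hb : ¬ b.holds c ph σ) (hq : Exec f c stream m q ph σ σ₁ t k) :
      Exec f c stream m (.ite b p q) ph σ σ₁ (1 + t) k
  | while_true {b p ph σ σ₁ σ₂ t₁ t₂ k₁ k₂} (hb : b.holds c ph σ)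
      (hp : Exec f c stream m p ph σ σ₁ t₁ k₁)
      (hw : Exec f c stream m (.while b p) ph σ₁ σ₂ t₂ k₂) :
      Exec f c stream m (.while b p) ph σ σ₂ (1 + t₁ + t₂) (k₁ + k₂)
  | while_false {b p ph σ} (hb : ¬ b.holds c ph σ) :
      Exec f c stream m (.while b p) ph σ σ 1 0
  | pass_start {p σ σ₁ t} (h : Exec f c stream m (.pass p) (.reading stream) σ σ₁ t 0) :
      Exec f c stream m (.pass p) .idle σ σ₁ (1 + t) 1
  | pass_item {p e l σ σ₁ σ₂ t₁ t₂} (hp : Exec f c stream m p (.item e) σ σ₁ t₁ 0)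
      (h : Exec f c stream m (.pass p) (.reading l) σ₁ σ₂ t₂ 0) :
      Exec f c stream m (.pass p) (.reading (e :: l)) σ σ₂ (1 + t₁ + t₂) 0
  | pass_end {p σ} : Exec f c stream m (.pass p) (.reading []) σ σ 1 0

end StreamRAM

/-!
Guessing the right density threshold reduces the problem to a sieve followed by the addition of one
item. Let `O` be an optimal set, `o` a largest item of `O`, `D = max (K - c o) 1`, and let `S` be
the set that is collected by keeping every arriving item which fits and whose marginal value is at
least `τ` times its size. If `S` leaves less room than `c o`, then `c(S) ≥ D`, hence `f(S) ≥ τ D`.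
Otherwise every item of `O` still fits, so those that are missing in `S` have been rejected for
their low density; by submodularity the items of `O` other than `o`, of total size at most `D`, add
at most `τ D` to `f(S + o)`, hence `f(S + o) ≥ f(O) - τ D`. Both bounds are `f(O) / 2` for
`τ = f(O) / (2 D)` (`sieve_or_augment`).

With `M` the largest value of a single item, this `τ` lies between `M / (2 K)` and `K M / 2`, so one
of the `O(ε⁻¹ log (K + 1))` thresholds `M (1 + ε) ^ j / (2 K)` is right up to a factor `1 + ε`
(`exists_threshold_half_le`, `exists_grid_length`). No guess of `f(O)` or of `c o` is needed. Three
passes suffice: one for `M`, one that runs the sieves for all thresholds in parallel, and one that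
finds the best set `S` or `S + e` over all thresholds and all items `e` that fit. The sets hold at
most `K` items each, and every pass spends a constant number of steps per item and threshold.

The program is analysed with rules for total correctness with resource bounds (`StreamRAM.Runs`).
-/

/-! ### Submodular functions -/

lemma IsSubmodular.union_sub_le_sum {E : Type*} [DecidableEq E] {f : Finset E → ℝ}
    (hf : IsSubmodular f) (A B : Finset E) :
    f (A ∪ B) - f A ≤ ∑ e ∈ B \ A, (f (insert e A) - f A) := by
  induction B using Finset.induction_on with
  | empty => simp
  | insert e B he ih =>
    by_cases heA : e ∈ A
    · rw [Finset.insert_sdiff_of_mem _ heA, Finset.union_insert,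
        Finset.insert_eq_of_mem (Finset.mem_union_left _ heA)]
      exact ih
    · rw [Finset.insert_sdiff_of_notMem _ heA, Finset.sum_insert (by simp [he]),
        Finset.union_insert]
      have := hf A (A ∪ B) Finset.subset_union_left e (by simp [heA, he])
      linarith

lemma totalSize_insert {E : Type*} [DecidableEq E] (c : E → ℕ) {S : Finset E} {e : E}
    (he : e ∉ S) : totalSize c (insert e S) = totalSize c S + c e := by
  rw [totalSize, Finset.sum_insert he, add_comm, totalSize]

lemma totalSize_insert_le {E : Type*} [DecidableEq E] (c : E → ℕ) (S : Finset E) (e : E) :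
    totalSize c (insert e S) ≤ totalSize c S + c e := by
  by_cases he : e ∈ S
  · simp [Finset.insert_eq_of_mem he]
  · exact (totalSize_insert c he).le

lemma totalSize_mono {E : Type*} (c : E → ℕ) {S T : Finset E} (h : S ⊆ T) :
    totalSize c S ≤ totalSize c T :=
  Finset.sum_le_sum_of_subset h

lemma card_le_totalSize {E : Type*} {c : E → ℕ} (hc : ∀ e, 1 ≤ c e) (S : Finset E) :
    S.card ≤ totalSize c S := by
  simpa [totalSize] using Finset.card_nsmul_le_sum S c 1 fun e _ => hc e

/-- A feasible set has at most `K` items, hence at most `K` times the value of the best item. -/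
lemma IsSubmodular.le_mul_of_singleton_le {E : Type*} [DecidableEq E] {f : Finset E → ℝ}
    (hf : IsSubmodular f) (h0 : ∀ S, 0 ≤ f S) {c : E → ℕ} (hc : ∀ e, 1 ≤ c e) {K : ℕ} {M : ℝ}
    (hM : ∀ e, f {e} ≤ M) {T : Finset E} (hT : totalSize c T ≤ K) (hne : T.Nonempty) :
    f T ≤ K * M := by
  have h := hf.union_sub_le_sum ∅ T
  simp only [Finset.empty_union, Finset.sdiff_empty, insert_empty_eq] at h
  obtain ⟨e, he⟩ := hne
  have hM0 : 0 ≤ M := (h0 _).trans (hM e)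
  have h1 : ∑ e ∈ T, (f {e} - f ∅) ≤ T.card * (M - f ∅) := by
    rw [← nsmul_eq_mul]
    exact Finset.sum_le_card_nsmul _ _ _ fun e _ => by linarith [hM e]
  have h2 : (1 : ℝ) ≤ T.card := by exact_mod_cast Finset.card_pos.2 ⟨e, he⟩
  have h3 : (T.card : ℝ) ≤ K := by exact_mod_cast (card_le_totalSize hc T).trans hT
  nlinarith [h0 ∅, mul_le_mul_of_nonneg_right h3 hM0, mul_le_mul_of_nonneg_right h2 (h0 ∅)]

/-! ### The density sieve -/

section Sieve

variable {E : Type*} [DecidableEq E] (f : Finset E → ℝ) (c : E → ℕ) (K : ℕ) (τ : ℝ)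

/-- One step of the density sieve: the arriving item `e` is kept if it fits and if its marginal
value is at least `τ` times its size. -/
noncomputable def sieveStep (S : Finset E) (e : E) : Finset E :=
  if totalSize c S + c e ≤ K ∧ τ * c e ≤ f (insert e S) - f S then insert e S else S

/-- The set that the density sieve with threshold `τ` collects from the stream `l`. -/
noncomputable def sieve (l : List E) : Finset E := l.foldl (sieveStep f c K τ) ∅

variable {f c K τ}

lemma sieve_nil : sieve f c K τ [] = ∅ := rfl

lemma sieve_concat (l : List E) (e : E) :
    sieve f c K τ (l ++ [e]) = sieveStep f c K τ (sieve f c K τ l) e := by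
  simp [sieve]

lemma subset_sieveStep (S : Finset E) (e : E) : S ⊆ sieveStep f c K τ S e := by
  unfold sieveStep; split_ifs <;> simp

lemma sieve_subset_append (l l' : List E) :
    sieve f c K τ l ⊆ sieve f c K τ (l ++ l') := by
  induction l' using List.reverseRecOn with
  | nil => simp
  | append_singleton l' e ih =>
    rw [← List.append_assoc, sieve_concat]
    exact ih.trans (subset_sieveStep _ _)

lemma mem_of_mem_sieve {l : List E} {x : E} (hx : x ∈ sieve f c K τ l) : x ∈ l := by
  induction l using List.reverseRecOn with
  | nil => simp [sieve_nil] at hx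
  | append_singleton l e ih =>
    rw [sieve_concat, sieveStep] at hx
    split_ifs at hx
    · rcases Finset.mem_insert.1 hx with rfl | hx
      · simp
      · simp [ih hx]
    · simp [ih hx]

lemma totalSize_sieve_le (l : List E) : totalSize c (sieve f c K τ l) ≤ K := by
  induction l using List.reverseRecOn with
  | nil => simp [sieve_nil, totalSize]
  | append_singleton l e ih =>
    rw [sieve_concat, sieveStep]
    split_ifs with h
    · exact (totalSize_insert_le c _ e).trans h.1
    · exact ih

lemma mul_totalSize_sieve_le (h0 : 0 ≤ f ∅) {l : List E} (hl : l.Nodup) :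
    τ * totalSize c (sieve f c K τ l) ≤ f (sieve f c K τ l) := by
  induction l using List.reverseRecOn with
  | nil => simpa [sieve_nil, totalSize] using h0
  | append_singleton l e ih =>
    rw [List.nodup_append] at hl
    have he : e ∉ sieve f c K τ l := fun h =>
      hl.2.2 e (mem_of_mem_sieve h) e (by simp) rfl
    have ih := ih hl.1
    rw [sieve_concat, sieveStep]
    split_ifs with h
    · rw [totalSize_insert c he]
      push_cast
      linarith [h.2]
    · exact ih

/-- An item that would still fit into the final set of the sieve has been rejected for its low
density, and its marginal value has only decreased since then. -/
lemma marginal_le_of_notMem_sieve (hf : IsSubmodular f) {l : List E} {e : E} (hel : e ∈ l)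
    (he : e ∉ sieve f c K τ l) (hfit : totalSize c (sieve f c K τ l) + c e ≤ K) {B : Finset E}
    (hB : sieve f c K τ l ⊆ B) (heB : e ∉ B) : f (insert e B) - f B ≤ τ * c e := by
  obtain ⟨l₁, l₂, rfl⟩ := List.append_of_mem hel
  have hsub : sieve f c K τ l₁ ⊆ sieve f c K τ (l₁ ++ e :: l₂) := sieve_subset_append _ _
  have he' : e ∉ sieve f c K τ (l₁ ++ [e]) := fun h => he <| by
    simpa using sieve_subset_append (l₁ ++ [e]) l₂ h
  rw [sieve_concat, sieveStep] at he'
  split_ifs at he' with h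
  · simp at he'
  · have h1 : totalSize c (sieve f c K τ l₁) + c e ≤ K :=
      (Nat.add_le_add_right (totalSize_mono c hsub) _).trans hfit
    have h2 := not_le.1 fun h2 => h ⟨h1, h2⟩
    linarith [hf _ B (hsub.trans hB) e heB]

/-- The key dichotomy. Let `o` be a largest item of a feasible set `T`. Either the sieve has left
less room than `c o`, and then its set is valuable because it is large, or all items of `T` still
fit, and then adding `o` alone recovers all of `f T` except what the rejected items of `T` other
than `o` can contribute. The maximum with `1` keeps the bound meaningful when `c o = K`. -/
lemma sieve_or_augment (h0 : ∀ S, 0 ≤ f S) (hmono : Monotone f) (hf : IsSubmodular f)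
    {l : List E} (hl : l.Nodup) (hall : ∀ e, e ∈ l) (hτ : 0 ≤ τ) {T : Finset E} {o : E}
    (hT : totalSize c T ≤ K) (ho : o ∈ T) (hmax : ∀ e ∈ T, c e ≤ c o) :
    τ * (max (K - c o) 1 : ℕ) ≤ f (sieve f c K τ l) ∨
      (totalSize c (sieve f c K τ l) + c o ≤ K ∧
        f T - τ * (max (K - c o) 1 : ℕ) ≤ f (insert o (sieve f c K τ l))) := by
  set S := sieve f c K τ l with hS
  have hTo : totalSize c (T.erase o) + c o = totalSize c T := Finset.sum_erase_add _ _ ho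
  by_cases hfit : totalSize c S + c o ≤ K
  · refine Or.inr ⟨hfit, ?_⟩
    have h1 := hf.union_sub_le_sum (insert o S) (T.erase o)
    have h2 : f T ≤ f (insert o S ∪ T.erase o) := hmono fun x hx => by
      by_cases hxo : x = o <;> simp [hxo, hx]
    have h3 : ∑ e ∈ T.erase o \ insert o S, (f (insert e (insert o S)) - f (insert o S)) ≤
        ∑ e ∈ T.erase o \ insert o S, τ * c e := by
      refine Finset.sum_le_sum fun e he => ?_
      rw [Finset.mem_sdiff, Finset.mem_erase] at he
      refine marginal_le_of_notMem_sieve hf (hall e) (fun h => he.2 (Finset.mem_insert_of_mem h))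
        ?_ (Finset.subset_insert _ _) he.2
      exact (Nat.add_le_add_left (hmax e he.1.2) _).trans hfit
    have h4 : ∑ e ∈ T.erase o \ insert o S, τ * (c e : ℝ) ≤ τ * (max (K - c o) 1 : ℕ) := by
      rw [← Finset.mul_sum, ← Nat.cast_sum]
      refine mul_le_mul_of_nonneg_left (Nat.cast_le.2 ?_) hτ
      have := totalSize_mono c (Finset.sdiff_subset (s := T.erase o) (t := insert o S))
      unfold totalSize at *
      omega
    linarith
  · refine Or.inl (le_trans ?_ (mul_totalSize_sieve_le (c := c) (K := K) (h0 ∅) hl))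
    refine mul_le_mul_of_nonneg_left (Nat.cast_le.2 ?_) hτ
    change max (K - c o) 1 ≤ totalSize c S
    omega

end Sieve

/-! ### The grid of thresholds -/

/-- The grid `M (1 + ε) ^ j / (2 K)` of thresholds, from `M / (2 K)` upwards. -/
noncomputable def threshold (ε : ℝ) (K : ℕ) (M : ℝ) (j : ℕ) : ℝ := M * (1 + ε) ^ j / (2 * K)

lemma exists_threshold_le {ε M x : ℝ} {K N : ℕ} (hε : 0 < ε) (hK : 1 ≤ K) (hM : 0 ≤ M)
    (hN : (K : ℝ) * K < (1 + ε) ^ N) (hlo : M / (2 * K) ≤ x) (hhi : x ≤ K * M / 2) :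
    ∃ j < N, threshold ε K M j ≤ x ∧ x ≤ (1 + ε) * threshold ε K M j := by
  classical
  have hK' : (1 : ℝ) ≤ K := by exact_mod_cast hK
  have hxN : x ≤ threshold ε K M N := by
    refine hhi.trans ?_
    rw [threshold, le_div_iff₀ (by positivity)]
    nlinarith [mul_le_mul_of_nonneg_left hN.le hM]
  have hN0 : N ≠ 0 := by
    rintro rfl
    simp only [pow_zero] at hN
    nlinarith
  have hex : ∃ n, x ≤ threshold ε K M n := ⟨N, hxN⟩
  have hspec := Nat.find_spec hex
  rcases hn : Nat.find hex with _ | n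
  · rw [hn] at hspec
    have h0 : threshold ε K M 0 = M / (2 * K) := by simp [threshold]
    refine ⟨0, by omega, h0 ▸ hlo, hspec.trans ?_⟩
    have : 0 ≤ threshold ε K M 0 := by rw [h0]; positivity
    nlinarith
  · have hle : Nat.find hex ≤ N := Nat.find_min' hex hxN
    refine ⟨n, by omega, (not_le.1 (Nat.find_min hex (m := n) (by omega))).le, ?_⟩
    rw [hn] at hspec
    refine hspec.trans_eq ?_
    rw [threshold, threshold, pow_succ]
    ring

/-- The powers of `1 + ε` up to `K ^ 2` are `O(ε⁻¹ log (K + 1))` many, because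
`2 ε / 3 ≤ log (1 + ε)`. -/
lemma exists_grid_length {K : ℕ} {ε : ℝ} (hε : 0 < ε) (hε' : ε ≤ 1 / 2) (hK : 1 ≤ K) :
    ∃ N : ℕ, (∀ j < N, (1 + ε) ^ j ≤ (K : ℝ) * K) ∧ (K : ℝ) * K < (1 + ε) ^ N ∧
      (N : ℝ) ≤ 4 * (ε⁻¹ * Real.log (K + 1)) := by
  classical
  have hK' : (1 : ℝ) ≤ K := by exact_mod_cast hK
  have hex : ∃ n : ℕ, (K : ℝ) * K < (1 + ε) ^ n := pow_unbounded_of_one_lt _ (by linarith)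
  refine ⟨Nat.find hex, fun j hj => not_lt.1 (Nat.find_min hex hj), Nat.find_spec hex, ?_⟩
  set N := Nat.find hex with hN
  have hN0 : N ≠ 0 := by
    intro h
    have := Nat.find_spec hex
    rw [← hN, h, pow_zero] at this
    nlinarith
  obtain ⟨n, hn⟩ := Nat.exists_eq_succ_of_ne_zero hN0
  have hle : (1 + ε) ^ n ≤ (K : ℝ) * K := not_lt.1 (Nat.find_min hex (m := n) (by omega))
  have hlog : n * Real.log (1 + ε) ≤ 2 * Real.log K := by
    have := Real.log_le_log (by positivity) hle
    rw [Real.log_pow, Real.log_mul (by positivity) (by positivity)] at this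
    linarith
  have h1 : 2 / 3 * ε ≤ Real.log (1 + ε) := by
    refine le_trans ?_ (Real.one_sub_inv_le_log_of_pos (by linarith))
    rw [← sub_nonneg]
    have : 1 - (1 + ε)⁻¹ - 2 / 3 * ε = ε * (1 - 2 * ε) / (3 * (1 + ε)) := by field_simp; ring
    rw [this]
    exact div_nonneg (mul_nonneg hε.le (by linarith)) (by linarith)
  have h2 : Real.log K ≤ Real.log (K + 1) := Real.log_le_log (by linarith) (by linarith)
  have h3 : 1 / 2 ≤ Real.log (K + 1) :=
    le_trans (by linarith [Real.log_two_gt_d9]) (Real.log_le_log two_pos (by linarith))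
  rw [mul_left_comm, inv_mul_eq_div, le_div_iff₀ hε, hn]
  push_cast
  nlinarith [mul_le_mul_of_nonneg_left h1 (Nat.cast_nonneg (α := ℝ) n)]

/-- Some threshold of the grid is right: its sieve, alone or with one more item that fits, reaches
almost half of the value of every feasible set. -/
theorem exists_threshold_half_le {E : Type*} [Fintype E] [DecidableEq E]
    {f : Finset E → ℝ} {c : E → ℕ} {K N : ℕ} {ε M : ℝ} {l : List E}
    (h0 : ∀ S, 0 ≤ f S) (hmono : Monotone f) (hf : IsSubmodular f)
    (hc : ∀ e, 1 ≤ c e ∧ c e ≤ K) (hl : l.Nodup) (hall : ∀ e, e ∈ l)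
    (hε : 0 < ε) (hε' : ε ≤ 1 / 2) (hK : 1 ≤ K) (hN : (K : ℝ) * K < (1 + ε) ^ N)
    (hM : IsLeast {V : ℝ | 0 ≤ V ∧ ∀ e ∈ l, f {e} ≤ V} M)
    {T : Finset E} (hT : totalSize c T ≤ K) :
    ∃ j < N, (1 / 2 - ε) * f T ≤ f (sieve f c K (threshold ε K M j) l) ∨
      ∃ e, totalSize c (sieve f c K (threshold ε K M j) l) + c e ≤ K ∧
        (1 / 2 - ε) * f T ≤ f (insert e (sieve f c K (threshold ε K M j) l)) := by
  have hK' : (1 : ℝ) ≤ K := by exact_mod_cast hK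
  obtain ⟨O, hO, hopt⟩ := Finset.exists_max_image
    (Finset.univ.filter fun T : Finset E => totalSize c T ≤ K) f ⟨T, by simpa using hT⟩
  have hOK : totalSize c O ≤ K := by simpa using hO
  have hTO : (1 / 2 - ε) * f T ≤ (1 / 2 - ε) * f O :=
    mul_le_mul_of_nonneg_left (hopt T (by simpa using hT)) (by linarith)
  have hN0 : 0 < N := by
    refine Nat.pos_of_ne_zero ?_
    rintro rfl
    simp only [pow_zero] at hN
    nlinarith
  have hMO : M ≤ f O := hM.2 ⟨h0 O, fun e _ => hopt {e} <|
    Finset.mem_filter.2 ⟨Finset.mem_univ _, by simpa [totalSize] using (hc e).2⟩⟩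
  rcases O.eq_empty_or_nonempty with rfl | hne
  · refine ⟨0, hN0, Or.inl (hTO.trans ?_)⟩
    nlinarith [h0 ∅, hmono (Finset.empty_subset (sieve f c K (threshold ε K M 0) l))]
  obtain ⟨o, ho, hmax⟩ := Finset.exists_max_image O c hne
  set D : ℕ := max (K - c o) 1 with hD
  have hD1 : (1 : ℝ) ≤ D := by exact_mod_cast le_max_right _ _
  have hDK : (D : ℝ) ≤ K := by exact_mod_cast (show D ≤ K by omega)
  have hOM : f O ≤ K * M :=
    hf.le_mul_of_singleton_le h0 (fun e => (hc e).1) (fun e => hM.1.2 e (hall e)) hOK hne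
  -- The ideal threshold `f O / (2 D)` balances the two cases of `sieve_or_augment`.
  obtain ⟨j, hj, hjle, hlej⟩ := exists_threshold_le (x := f O / (2 * D)) hε hK hM.1.1 hN
    (div_le_div₀ (h0 O) hMO (by positivity) (by linarith))
    ((div_le_iff₀ (by positivity)).2 <| by
      nlinarith [mul_le_mul_of_nonneg_left hD1 ((h0 O).trans hOM)])
  have hτ : 0 ≤ threshold ε K M j := by
    have := hM.1.1
    unfold threshold
    positivity
  rw [le_div_iff₀ (by positivity)] at hjle
  rw [div_le_iff₀ (by positivity)] at hlej
  refine ⟨j, hj, ?_⟩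
  rcases sieve_or_augment h0 hmono hf hl hall hτ hOK ho hmax with h | ⟨h1, h2⟩
  · left
    have h3 : (1 / 2 - ε) * f O ≤ (1 / 2 - ε) * ((1 + ε) * threshold ε K M j * (2 * D)) :=
      mul_le_mul_of_nonneg_left hlej (by linarith)
    have h4 : 0 ≤ threshold ε K M j * D := by positivity
    have h5 : (1 - 2 * ε) * (1 + ε) ≤ 1 := by nlinarith
    nlinarith [mul_le_mul_of_nonneg_right h5 h4]
  · right
    refine ⟨o, h1, ?_⟩
    nlinarith [h0 O]

namespace StreamRAM

/-! ### Bounded executions -/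

section Runs

variable {E : Type*}

@[simp] lemma setNum_num (σ : State E) (a b : ℕ) (r : ℝ) :
    (σ.setNum a r).num b = if b = a then r else σ.num b := Function.update_apply ..

@[simp] lemma setNum_idx (σ : State E) (a : ℕ) (r : ℝ) : (σ.setNum a r).idx = σ.idx := rfl

@[simp] lemma setNum_reg (σ : State E) (a : ℕ) (r : ℝ) : (σ.setNum a r).reg = σ.reg := rfl

@[simp] lemma setIdx_idx (σ : State E) (x y v : ℕ) :
    (σ.setIdx x v).idx y = if y = x then v else σ.idx y := Function.update_apply ..

@[simp] lemma setIdx_num (σ : State E) (x v : ℕ) : (σ.setIdx x v).num = σ.num := rfl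

@[simp] lemma setIdx_reg (σ : State E) (x v : ℕ) : (σ.setIdx x v).reg = σ.reg := rfl

@[simp] lemma setReg_reg (σ : State E) (s t : ℕ) (S : Finset E) :
    (σ.setReg s S).reg t = if t = s then S else σ.reg t := Function.update_apply ..

@[simp] lemma setReg_num (σ : State E) (s : ℕ) (S : Finset E) : (σ.setReg s S).num = σ.num := rfl

@[simp] lemma setReg_idx (σ : State E) (s : ℕ) (S : Finset E) : (σ.setReg s S).idx = σ.idx := rfl

lemma stored_le {σ : State E} {B L : ℕ} (m : ℕ) (h : ∀ j, (σ.reg j).card ≤ B)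
    (h' : ∀ j, L ≤ j → σ.reg j = ∅) : σ.stored m ≤ L * B := by
  calc σ.stored m ≤ ∑ j ∈ Finset.range (max m L), (σ.reg j).card :=
        Finset.sum_le_sum_of_subset (by simp)
    _ = ∑ j ∈ Finset.range L, (σ.reg j).card := by
        refine (Finset.sum_subset (by simp) fun j _ hj => ?_).symm
        rw [h' j (by simpa using hj), Finset.card_empty]
    _ ≤ L * B := by simpa using Finset.sum_le_card_nsmul (Finset.range L) _ B fun j _ => h j

variable [DecidableEq E] (f : Finset E → ℝ) (c : E → ℕ) (stream : List E) (m : ℕ)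

/-- Total correctness with resource bounds: started from `σ`, the program `p` halts within `T` steps
and `k` passes, in a memory of size `m`, in a state that satisfies `Q`. -/
def Runs (p : Prog) (ph : Phase E) (σ : State E) (T k : ℕ) (Q : State E → Prop) : Prop :=
  ∃ σ' t k', Exec f c stream m p ph σ σ' t k' ∧ t ≤ T ∧ k' ≤ k ∧ Q σ'

variable {f c stream m} {p q : Prog} {b : Test} {ph : Phase E} {σ : State E} {T T₁ T₂ k k₁ k₂ : ℕ}
  {Q R : State E → Prop}

namespace Runs

lemma of_le {T' k' : ℕ} (h : Runs f c stream m p ph σ T k Q) (hT : T ≤ T') (hk : k ≤ k') :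
    Runs f c stream m p ph σ T' k' Q := by
  obtain ⟨σ', t, k₁, h1, h2, h3, h4⟩ := h
  exact ⟨σ', t, k₁, h1, h2.trans hT, h3.trans hk, h4⟩

lemma mono (h : Runs f c stream m p ph σ T k Q) (hQ : ∀ σ', Q σ' → R σ') :
    Runs f c stream m p ph σ T k R := by
  obtain ⟨σ', t, k₁, h1, h2, h3, h4⟩ := h
  exact ⟨σ', t, k₁, h1, h2, h3, hQ _ h4⟩

lemma skip (hQ : Q σ) : Runs f c stream m .skip ph σ (T + 1) k Q :=
  ⟨_, _, _, .skip _ _, by omega, by omega, hQ⟩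

lemma setIdx {x : ℕ} {a : IExp} (hx : x < m) (hv : a.eval σ ≤ m) (hQ : Q (σ.setIdx x (a.eval σ))) :
    Runs f c stream m (.setIdx x a) ph σ (T + 1) k Q :=
  ⟨_, _, _, .setIdx _ _ _ _ hx hv, by omega, by omega, hQ⟩

lemma setNum {a : IExp} {x : RExp} (ha : a.eval σ < m)
    (hQ : Q (σ.setNum (a.eval σ) (x.eval c ph σ))) :
    Runs f c stream m (.setNum a x) ph σ (T + 1) k Q :=
  ⟨_, _, _, .setNum _ _ _ _ ha, by omega, by omega, hQ⟩

lemma query {a s : IExp} (ha : a.eval σ < m)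
    (hQ : Q (σ.setNum (a.eval σ) (f (σ.reg (s.eval σ))))) :
    Runs f c stream m (.query a s) ph σ (T + 1) k Q :=
  ⟨_, _, _, .query _ _ _ _ ha, by omega, by omega, hQ⟩

lemma queryAdd {e : E} {a s : IExp} (ha : a.eval σ < m)
    (hQ : Q (σ.setNum (a.eval σ) (f (Insert.insert e (σ.reg (s.eval σ)))))) :
    Runs f c stream m (.queryAdd a s) (.item e) σ (T + 1) k Q :=
  ⟨_, _, _, .queryAdd _ _ _ _ ha, by omega, by omega, hQ⟩

lemma clear {s : IExp} (hs : s.eval σ < m) (hQ : Q (σ.setReg (s.eval σ) ∅)) :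
    Runs f c stream m (.clear s) ph σ (T + 1) k Q :=
  ⟨_, _, _, .clear _ _ _ hs, by omega, by omega, hQ⟩

lemma insert {e : E} {s : IExp} (hs : s.eval σ < m)
    (hm : (σ.setReg (s.eval σ) (Insert.insert e (σ.reg (s.eval σ)))).stored m ≤ m)
    (hQ : Q (σ.setReg (s.eval σ) (Insert.insert e (σ.reg (s.eval σ))))) :
    Runs f c stream m (.insert s) (.item e) σ (T + 1) k Q :=
  ⟨_, _, _, .insert _ _ _ hs hm, by omega, by omega, hQ⟩

lemma union {s s' : IExp} (hs : s.eval σ < m)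
    (hm : (σ.setReg (s.eval σ) (σ.reg (s.eval σ) ∪ σ.reg (s'.eval σ))).stored m ≤ m)
    (hT : (σ.reg (s'.eval σ)).card ≤ T)
    (hQ : Q (σ.setReg (s.eval σ) (σ.reg (s.eval σ) ∪ σ.reg (s'.eval σ)))) :
    Runs f c stream m (.union s s') ph σ (T + 1) k Q :=
  ⟨_, _, _, .union _ _ _ _ hs hm, by omega, by omega, hQ⟩

lemma seq (h : Runs f c stream m p ph σ T₁ k₁ fun σ₁ => Runs f c stream m q ph σ₁ T₂ k₂ Q) :
    Runs f c stream m (.seq p q) ph σ (T₁ + T₂) (k₁ + k₂) Q := by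
  obtain ⟨σ₁, t₁, l₁, h1, h2, h3, σ₂, t₂, l₂, h4, h5, h6, h7⟩ := h
  exact ⟨σ₂, _, _, .seq h1 h4, by omega, by omega, h7⟩

/-- The rule for a sequence whose first instruction takes one step. -/
lemma step (h : Runs f c stream m p ph σ 1 0 fun σ₁ => Runs f c stream m q ph σ₁ T k Q) :
    Runs f c stream m (.seq p q) ph σ (T + 1) k Q :=
  (seq h).of_le (by omega) (by omega)

lemma ite (hp : b.holds c ph σ → Runs f c stream m p ph σ T k Q)
    (hq : ¬ b.holds c ph σ → Runs f c stream m q ph σ T k Q) :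
    Runs f c stream m (.ite b p q) ph σ (T + 1) k Q := by
  by_cases hb : b.holds c ph σ
  · obtain ⟨σ₁, t₁, l₁, h1, h2, h3, h4⟩ := hp hb
    exact ⟨σ₁, _, _, .ite_true hb h1, by omega, by omega, h4⟩
  · obtain ⟨σ₁, t₁, l₁, h1, h2, h3, h4⟩ := hq hb
    exact ⟨σ₁, _, _, .ite_false hb h1, by omega, by omega, h4⟩

/-- The rule for a loop that is known to run its body `n` times; `P j` holds after `j` rounds. -/
lemma while_count {n : ℕ} {P : ℕ → State E → Prop}
    (hbody : ∀ j < n, ∀ σ, P j σ → b.holds c ph σ ∧ Runs f c stream m p ph σ T 0 (P (j + 1)))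
    (hend : ∀ σ, P n σ → ¬ b.holds c ph σ) (h0 : P 0 σ) :
    Runs f c stream m (.while b p) ph σ (n * (T + 1) + 1) 0 (P n) := by
  suffices H : ∀ i ≤ n, ∀ σ, P (n - i) σ →
      Runs f c stream m (.while b p) ph σ (i * (T + 1) + 1) 0 (P n) from
    H n le_rfl σ (by simpa using h0)
  intro i
  induction i with
  | zero => exact fun _ σ h => ⟨σ, _, _, .while_false (hend σ h), by omega, by omega, h⟩
  | succ i ih =>
    intro hi σ h
    obtain ⟨hb, σ₁, t₁, l₁, h1, h2, h3, h4⟩ := hbody (n - (i + 1)) (by omega) σ h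
    rw [show n - (i + 1) + 1 = n - i by omega] at h4
    obtain ⟨σ₂, t₂, l₂, h5, h6, h7, h8⟩ := ih (by omega) σ₁ h4
    exact ⟨σ₂, _, _, .while_true hb h1 h5, by rw [Nat.succ_mul]; omega, by omega, h8⟩

/-- The rule for a pass; `P l` holds when the items in `l` have been read. -/
lemma pass {P : List E → State E → Prop}
    (hbody : ∀ l e l', stream = l ++ e :: l' → ∀ σ, P l σ →
      Runs f c stream m p (.item e) σ T 0 (P (l ++ [e])))
    (h0 : P [] σ) :
    Runs f c stream m (.pass p) .idle σ (stream.length * (T + 1) + 2) 1 (P stream) := by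
  suffices H : ∀ l' l, stream = l ++ l' → ∀ σ, P l σ → ∃ σ' t,
      Exec f c stream m (.pass p) (.reading l') σ σ' t 0 ∧ t ≤ l'.length * (T + 1) + 1 ∧
        P stream σ' by
    obtain ⟨σ', t, h1, h2, h3⟩ := H stream [] rfl σ h0
    exact ⟨σ', _, _, .pass_start h1, by omega, le_rfl, h3⟩
  intro l'
  induction l' with
  | nil =>
    rintro l hl σ h
    rw [List.append_nil] at hl
    exact ⟨σ, _, .pass_end, by omega, hl ▸ h⟩
  | cons e l' ih =>
    intro l hl σ h
    obtain ⟨σ₁, t₁, l₁, h1, h2, h3, h4⟩ := hbody l e l' hl σ h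
    obtain ⟨σ₂, t₂, h5, h6, h7⟩ := ih (l ++ [e]) (by simpa using hl) σ₁ h4
    obtain rfl : l₁ = 0 := by omega
    exact ⟨σ₂, _, .pass_item h1 h5, by rw [List.length_cons, Nat.succ_mul]; omega, h7⟩

end Runs

end Runs

/-! ### The program -/

/-- The address of the set of the current threshold. -/
abbrev curSet : IExp := .add (.var 0) (.const 2)

/-- The address of the size of the set of the current threshold. -/
abbrev curSize : IExp := .add (.var 0) (.const 7)

/-- The test whether the current item fits into the set of the current threshold. -/
abbrev fits : Test := .leNum (.add (.cell curSize) .itemSize) (.cell (.const 1))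

/-- Run `body` for all thresholds of the grid: index variable `0` is the index `j` of the current
threshold, and cell `5` holds `(1 + ε) ^ j`. The loop ends when this power exceeds `K ^ 2`. -/
def gridLoop (body : Prog) : Prog :=
  .seq (.setNum (.const 5) (.ofIdx (.const 1))) <|
  .seq (.setIdx 0 (.const 0)) <|
  .while (.leNum (.cell (.const 5)) (.mul (.cell (.const 1)) (.cell (.const 1)))) <|
  .seq body <|
  .seq (.setNum (.const 5)
    (.mul (.cell (.const 5)) (.add (.ofIdx (.const 1)) (.cell (.const 0))))) <|
  .setIdx 0 (.add (.var 0) (.const 1))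

/-- The body of the first pass: update the largest value `M` of a single item, in cell `2`. -/
def maxBody : Prog :=
  .seq (.queryAdd (.const 3) (.const 0)) <|
  .ite (.leNum (.cell (.const 2)) (.cell (.const 3))) (.setNum (.const 2) (.cell (.const 3))) .skip

/-- The body of the second pass, for one threshold: a step of the density sieve. -/
def sieveBody : Prog :=
  .seq (.queryAdd (.const 3) curSet) <|
  .seq (.query (.const 4) curSet) <|
  .ite fits
    (.ite (.leNum
        (.mul (.div (.mul (.cell (.const 2)) (.cell (.const 5)))
          (.mul (.ofIdx (.const 2)) (.cell (.const 1)))) .itemSize)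
        (.sub (.cell (.const 3)) (.cell (.const 4))))
      (.seq (.insert curSet) (.setNum curSize (.add (.cell curSize) .itemSize)))
      .skip)
    .skip

/-- The body of the third pass, for one threshold: compare the set of this threshold, augmented by
the current item if it fits, with the best candidate so far. The value of the best candidate is in
cell `6`, the index of its threshold in index variable `1`, and its additional item, if any, in set
register `1`. -/
def augmentBody : Prog :=
  .seq (.ite fits (.queryAdd (.const 3) curSet) (.query (.const 3) curSet)) <|
  .ite (.leNum (.cell (.const 6)) (.cell (.const 3)))
    (.seq (.setNum (.const 6) (.cell (.const 3))) <|
      .seq (.setIdx 1 (.var 0)) <|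
      .seq (.clear (.const 1)) <|
      .ite fits (.insert (.const 1)) .skip)
    .skip

/-- Find the best single item, run all sieves in parallel, and find the best augmentation.

The set of threshold `j` is in set register `j + 2` and its size in cell `j + 7`. Only the index of
the best threshold and the additional item are recorded during the third pass, since copying the
whole set at every improvement would take too much time. -/
def knapsackProg : Prog :=
  .seq (.pass maxBody) <|
  .seq (.pass (gridLoop sieveBody)) <|
  .seq (.setNum (.const 6) (.ofIdx (.const 0))) <|
  .seq (.setIdx 1 (.const 0)) <|
  .seq (.clear (.const 1)) <|
  .seq (.pass (gridLoop augmentBody)) <|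
  .seq (.union (.const 0) (.add (.var 1) (.const 2))) <|
  .union (.const 0) (.const 1)

/-! ### The content of the memory -/

section Program

variable {E : Type*} {c : E → ℕ} {m K N : ℕ} {ε M : ℝ}

/-- The state belongs to round `j` of the loop over the grid. -/
structure AtGrid (ε : ℝ) (j : ℕ) (σ : State E) : Prop where
  idx : σ.idx 0 = j
  pow : σ.num 5 = (1 + ε) ^ j

/-- The memory holds the inputs, the value `M`, the sets `A j` and their sizes. -/
structure Stores (c : E → ℕ) (ε : ℝ) (K : ℕ) (M : ℝ) (A : ℕ → Finset E) (σ : State E) : Prop where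
  eps : σ.num 0 = ε
  cap : σ.num 1 = K
  best : σ.num 2 = M
  out : σ.reg 0 = ∅
  extra : (σ.reg 1).card ≤ 1
  sets : ∀ j, σ.reg (j + 2) = A j
  sizes : ∀ j, σ.num (j + 7) = totalSize c (A j)

lemma Stores.setNum {A : ℕ → Finset E} {σ : State E} (h : Stores c ε K M A σ) {a : ℕ}
    (ha : 2 < a ∧ a < 7) (x : ℝ) : Stores c ε K M A (σ.setNum a x) := by
  refine ⟨?_, ?_, ?_, h.out, h.extra, h.sets, fun j => ?_⟩
  · rw [setNum_num, if_neg (by omega), h.eps]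
  · rw [setNum_num, if_neg (by omega), h.cap]
  · rw [setNum_num, if_neg (by omega), h.best]
  · rw [setNum_num, if_neg (by omega), h.sizes]

lemma Stores.setIdx {A : ℕ → Finset E} {σ : State E} (h : Stores c ε K M A σ) (x v : ℕ) :
    Stores c ε K M A (σ.setIdx x v) :=
  ⟨h.eps, h.cap, h.best, h.out, h.extra, h.sets, h.sizes⟩

lemma Stores.setExtra {A : ℕ → Finset E} {σ : State E} (h : Stores c ε K M A σ) {S : Finset E}
    (hS : S.card ≤ 1) : Stores c ε K M A (σ.setReg 1 S) := by
  refine ⟨h.eps, h.cap, h.best, by simpa using h.out, by simpa using hS, fun j => ?_, h.sizes⟩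
  simpa using h.sets j

lemma Stores.holds_fits {A : ℕ → Finset E} {σ : State E} {j : ℕ} {e : E}
    (h : Stores c ε K M A σ) (hj : σ.idx 0 = j) :
    fits.holds c (.item e) σ ↔ totalSize c (A j) + c e ≤ K := by
  simp only [Test.holds, RExp.eval, IExp.eval, Phase.size, hj, h.sizes, h.cap]
  exact_mod_cast Iff.rfl

/-- Overwriting one register by a set of size at most `K` respects the bound on the memory. -/
lemma Stores.stored_setReg_le {A : ℕ → Finset E} {σ : State E} (h : Stores c ε K M A σ)
    (hc : ∀ e, 1 ≤ c e) (hK : 1 ≤ K) (hA : ∀ j, totalSize c (A j) ≤ K) (hA' : ∀ j, N ≤ j → A j = ∅)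
    {s : ℕ} (hs : s < N + 2) {S : Finset E} (hS : totalSize c S ≤ K) :
    (σ.setReg s S).stored m ≤ (N + 2) * K := by
  refine stored_le m (fun j => ?_) fun j hj => ?_
  · rw [setReg_reg]
    split_ifs
    · exact (card_le_totalSize hc S).trans hS
    · match j with
      | 0 => simp [h.out]
      | 1 => exact h.extra.trans hK
      | j + 2 =>
        rw [h.sets]
        exact (card_le_totalSize hc _).trans (hA j)
  · obtain ⟨j, rfl⟩ : ∃ i, j = i + 2 := ⟨j - 2, by omega⟩
    rw [setReg_reg, if_neg (by omega), h.sets, hA' j (by omega)]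

/-! ### Correctness of the loop over the grid -/

variable [DecidableEq E] {f : Finset E → ℝ} {stream : List E}

lemma Runs.gridLoop {body : Prog} {ph : Phase E} {σ : State E} {T : ℕ} {P : ℕ → State E → Prop}
    (hm : N + 11 ≤ m) (hN : ∀ j < N, (1 + ε) ^ j ≤ (K : ℝ) * K)
    (hN' : (K : ℝ) * K < (1 + ε) ^ N)
    (hcells : ∀ j σ, P j σ → σ.num 0 = ε ∧ σ.num 1 = K)
    (hnum : ∀ j σ x, P j σ → P j (σ.setNum 5 x)) (hidx : ∀ j σ v, P j σ → P j (σ.setIdx 0 v))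
    (hbody : ∀ j < N, ∀ σ, P j σ → AtGrid ε j σ →
      Runs f c stream m body ph σ T 0 fun σ' => P (j + 1) σ' ∧ AtGrid ε j σ')
    (h0 : P 0 σ) :
    Runs f c stream m (gridLoop body) ph σ (N * (T + 3) + 3) 0 (P N) := by
  refine Runs.step (Runs.setNum (by simp [IExp.eval]; omega) ?_)
  refine Runs.step (Runs.setIdx (by omega) (by simp [IExp.eval]) ?_)
  refine (Runs.while_count (n := N) (T := T + 2) (P := fun j σ => P j σ ∧ AtGrid ε j σ)
    ?_ ?_ ?_).mono fun _ h => h.1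
  · rintro j hj σ ⟨h, hg⟩
    refine ⟨?_, Runs.seq (T₁ := T) (T₂ := 2) (k₁ := 0) (k₂ := 0) ((hbody j hj σ h hg).mono ?_)⟩
    · simpa [Test.holds, RExp.eval, IExp.eval, hg.pow, (hcells j σ h).2] using hN j hj
    · rintro σ₁ ⟨h₁, hg₁⟩
      refine Runs.step (Runs.setNum (by simp [IExp.eval]; omega) ?_)
      refine Runs.setIdx (by omega) (by simp [IExp.eval, hg₁.idx]; omega)
        ⟨hidx _ _ _ (hnum _ _ _ h₁), ?_⟩
      constructor
      · simp [IExp.eval, hg₁.idx]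
      · simp [IExp.eval, RExp.eval, hg₁.pow, (hcells _ _ h₁).1, pow_succ]
  · rintro σ ⟨h, hg⟩
    simpa [Test.holds, RExp.eval, IExp.eval, hg.pow, (hcells N σ h).2] using hN'
  · exact ⟨hidx _ _ _ (hnum _ _ _ h0), by simp [IExp.eval], by simp [IExp.eval, RExp.eval]⟩

/-! ### Correctness of the three passes -/

lemma runs_pass_maxBody (hm : 11 ≤ m) :
    Runs f c stream m (.pass maxBody) .idle (State.init E ε K) (stream.length * 4 + 2) 1 fun σ =>
      IsLeast {V : ℝ | 0 ≤ V ∧ ∀ e ∈ stream, f {e} ≤ V} (σ.num 2) ∧ σ.num 0 = ε ∧ σ.num 1 = K ∧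
        (∀ j, σ.num (j + 7) = 0) ∧ ∀ j, σ.reg j = ∅ := by
  refine Runs.pass (T := 3) (P := fun l σ =>
      IsLeast {V : ℝ | 0 ≤ V ∧ ∀ e ∈ l, f {e} ≤ V} (σ.num 2) ∧ σ.num 0 = ε ∧ σ.num 1 = K ∧
        (∀ j, σ.num (j + 7) = 0) ∧ ∀ j, σ.reg j = ∅) ?_ ?_
  · rintro l e l' - σ ⟨⟨⟨h0, h1⟩, h2⟩, h3, h4, h5, h6⟩
    refine Runs.step (Runs.queryAdd (by simp [IExp.eval]; omega) ?_)
    refine Runs.ite (fun hb => ?_) (fun hb => ?_)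
    · refine Runs.setNum (by simp [IExp.eval]; omega) ?_
      simp only [Test.holds, RExp.eval, IExp.eval, setNum_num, h6, insert_empty_eq] at hb
      norm_num at hb
      simp only [RExp.eval, IExp.eval, setNum_num, setNum_reg, h6, insert_empty_eq]
      refine ⟨?_, by simpa using h3, by simpa using h4, fun j => by simpa using h5 j, by simp⟩
      norm_num
      refine ⟨⟨h0.trans hb, fun x hx => ?_⟩, fun V hV => hV.2 e (by simp)⟩
      rcases hx with hx | rfl
      · exact (h1 x hx).trans hb
      · exact le_rfl
    · refine Runs.skip ?_
      simp only [Test.holds, RExp.eval, IExp.eval, setNum_num, h6, insert_empty_eq] at hb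
      norm_num at hb
      simp only [IExp.eval, setNum_num, setNum_reg, h6, insert_empty_eq]
      refine ⟨?_, by simpa using h3, by simpa using h4, fun j => by simpa using h5 j, by simp⟩
      norm_num
      refine ⟨⟨h0, fun x hx => ?_⟩, fun V hV => h2 ⟨hV.1, fun x hx => hV.2 x (by simp [hx])⟩⟩
      rcases hx with hx | rfl
      · exact h1 x hx
      · exact hb.le
  · refine ⟨⟨by simp [State.init], fun V hV => by simpa [State.init] using hV.1⟩, ?_⟩
    simp [State.init]

lemma runs_sieveBody {A : ℕ → Finset E} {σ : State E} {j : ℕ} {e : E}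
    (hm : N + 11 ≤ m) (hm' : (N + 2) * K ≤ m) (hc : ∀ e, 1 ≤ c e) (hK : 1 ≤ K)
    (hA : ∀ j, totalSize c (A j) ≤ K) (hA' : ∀ j, N ≤ j → A j = ∅) (hj : j < N) (he : e ∉ A j)
    (h : Stores c ε K M A σ) (hg : AtGrid ε j σ) :
    Runs f c stream m sieveBody (.item e) σ 6 0 fun σ' =>
      Stores c ε K M
        (Function.update A j (sieveStep f c K (threshold ε K M j) (A j) e)) σ' ∧
      AtGrid ε j σ' := by
  have hj0 := hg.idx
  refine Runs.step (Runs.queryAdd (by simp [IExp.eval]; omega) ?_)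
  refine Runs.step (Runs.query (by simp [IExp.eval]; omega) ?_)
  have e3 : (IExp.const 3).eval σ = 3 := rfl
  have e4 (τ : State E) : (IExp.const 4).eval τ = 4 := rfl
  have ec (τ : State E) (hτ : τ.idx 0 = j) : curSet.eval τ = j + 2 := by simp [IExp.eval, hτ]
  have es (τ : State E) (hτ : τ.idx 0 = j) : curSize.eval τ = j + 7 := by simp [IExp.eval, hτ]
  rw [e3, e4, ec σ hj0, ec _ (by simpa using hj0), setNum_reg, h.sets]
  set σ₂ := (σ.setNum 3 (f (Insert.insert e (A j)))).setNum 4 (f (A j)) with hσ₂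
  have h₂ : Stores c ε K M A σ₂ := (h.setNum (by omega) _).setNum (by omega) _
  have hg₂ : AtGrid ε j σ₂ := ⟨by simpa [hσ₂] using hj0, by simpa [hσ₂] using hg.pow⟩
  have hdense : (Test.leNum (.mul (.div (.mul (.cell (.const 2)) (.cell (.const 5)))
      (.mul (.ofIdx (.const 2)) (.cell (.const 1)))) .itemSize)
      (.sub (.cell (.const 3)) (.cell (.const 4)))).holds c (.item e) σ₂ ↔
      threshold ε K M j * c e ≤ f (Insert.insert e (A j)) - f (A j) := by
    have n3 : σ₂.num 3 = f (Insert.insert e (A j)) := by simp [hσ₂]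
    have n4 : σ₂.num 4 = f (A j) := by simp [hσ₂]
    simp [Test.holds, RExp.eval, IExp.eval, Phase.size, h₂.best, h₂.cap, hg₂.pow, n3, n4,
      threshold]
  refine Runs.ite (fun hb => ?_) (fun hb => ?_)
  · rw [h₂.holds_fits hg₂.idx] at hb
    have hsize : totalSize c (Insert.insert e (A j)) ≤ K := (totalSize_insert_le c _ e).trans hb
    refine Runs.ite (fun hb' => ?_) (fun hb' => ?_)
    · rw [hdense] at hb'
      rw [sieveStep, if_pos ⟨hb, hb'⟩]
      refine Runs.step (Runs.insert ?_ ?_ ?_)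
      · rw [ec _ hg₂.idx]; omega
      · rw [ec _ hg₂.idx, h₂.sets]
        exact (h₂.stored_setReg_le hc hK hA hA' (by omega) hsize).trans hm'
      · rw [ec _ hg₂.idx, h₂.sets]
        refine Runs.setNum ?_ ?_
        · rw [es (σ₂.setReg _ _) hg₂.idx]; omega
        · rw [es (σ₂.setReg _ _) hg₂.idx]
          refine ⟨⟨?_, ?_, ?_, ?_, ?_, fun i => ?_, fun i => ?_⟩, ⟨hg₂.idx, ?_⟩⟩
          · simpa using h₂.eps
          · simpa using h₂.cap
          · simpa using h₂.best
          · simpa using h₂.out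
          · simpa using h₂.extra
          · by_cases hi : i = j
            · subst hi; simp
            · simpa [hi] using h₂.sets i
          · by_cases hi : i = j
            · subst hi
              simp [RExp.eval, IExp.eval, hg₂.idx, h₂.sizes, Phase.size, totalSize_insert c he]
            · simpa [hi] using h₂.sizes i
          · have : (5 : ℕ) ≠ j + 7 := by omega
            simpa [this] using hg₂.pow
    · rw [hdense] at hb'
      rw [sieveStep, if_neg fun h => hb' h.2, Function.update_eq_self]
      exact Runs.skip ⟨h₂, hg₂⟩
  · rw [h₂.holds_fits hg₂.idx] at hb
    rw [sieveStep, if_neg fun h => hb h.1, Function.update_eq_self]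
    exact Runs.skip ⟨h₂, hg₂⟩

/-- The sets of all sieves after the items of `l` have been read. -/
noncomputable def sieves (f : Finset E → ℝ) (c : E → ℕ) (K : ℕ) (ε M : ℝ) (N : ℕ) (l : List E)
    (j : ℕ) : Finset E :=
  if j < N then sieve f c K (threshold ε K M j) l else ∅

lemma totalSize_sieves_le (l : List E) (j : ℕ) : totalSize c (sieves f c K ε M N l j) ≤ K := by
  unfold sieves
  split_ifs
  · exact totalSize_sieve_le l
  · simp [totalSize]

lemma sieves_of_le (l : List E) (j : ℕ) (hj : N ≤ j) : sieves f c K ε M N l j = ∅ := by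
  rw [sieves, if_neg (by omega)]

lemma runs_pass_sieveBody {σ : State E} (hm : N + 11 ≤ m) (hm' : (N + 2) * K ≤ m)
    (hN : ∀ j < N, (1 + ε) ^ j ≤ (K : ℝ) * K) (hN' : (K : ℝ) * K < (1 + ε) ^ N)
    (hc : ∀ e, 1 ≤ c e) (hK : 1 ≤ K) (hl : stream.Nodup)
    (h : Stores c ε K M (fun _ => ∅) σ) :
    Runs f c stream m (.pass (gridLoop sieveBody)) .idle σ
      (stream.length * (N * 9 + 4) + 2) 1 (Stores c ε K M (sieves f c K ε M N stream)) := by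
  refine Runs.pass (T := N * 9 + 3) (P := fun l => Stores c ε K M (sieves f c K ε M N l)) ?_ ?_
  · rintro l e l' rfl σ h
    have hel : e ∉ l := fun hel => (List.nodup_append.1 hl).2.2 e hel e (by simp) rfl
    -- In round `j`, the sieves below `j` have already read `e`, the others have not.
    let A (j i : ℕ) := if i < j then sieves f c K ε M N (l ++ [e]) i else sieves f c K ε M N l i
    have hA0 : A 0 = sieves f c K ε M N l := by ext1 i; simp [A]
    have hAN : A N = sieves f c K ε M N (l ++ [e]) := by
      ext1 i
      by_cases hi : i < N
      · simp [A, hi]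
      · simp [A, hi, sieves_of_le _ i (not_lt.1 hi)]
    rw [← hAN]
    refine Runs.gridLoop (T := 6) (P := fun j => Stores c ε K M (A j)) hm hN hN'
      (fun j σ h => ⟨h.eps, h.cap⟩) (fun j σ x h => h.setNum (by omega) x)
      (fun j σ v h => h.setIdx 0 v) ?_ (hA0 ▸ h)
    intro j hj σ h hg
    have hAj : A j j = sieve f c K (threshold ε K M j) l := by simp [A, sieves, hj]
    have hAs : Function.update (A j) j (sieveStep f c K (threshold ε K M j) (A j j) e) =
        A (j + 1) := by
      ext1 i
      by_cases hi : i = j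
      · subst hi
        simp [← sieve_concat, A, sieves, hj]
      · have : i < j + 1 ↔ i < j := by omega
        simp [hi, A, this]
    rw [← hAs]
    refine runs_sieveBody hm hm' hc hK (fun i => ?_) (fun i hi => ?_) hj ?_ h hg
    · simp only [A]; split_ifs <;> exact totalSize_sieves_le _ _
    · simp only [A]; split_ifs <;> exact sieves_of_le _ _ hi
    · rw [hAj]; exact fun h => hel (mem_of_mem_sieve h)
  · convert h using 1
    ext1 j
    simp [sieves, sieve_nil]

/-- `r` is at least the value of `S`, and of `S` with the item `e` if it fits. -/
def Covers (f : Finset E → ℝ) (c : E → ℕ) (K : ℕ) (S : Finset E) (e : E) (r : ℝ) : Prop :=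
  f S ≤ r ∧ (totalSize c S + c e ≤ K → f (insert e S) ≤ r)

lemma Covers.mono {S : Finset E} {e : E} {r r' : ℝ} (h : Covers f c K S e r) (hr : r ≤ r') :
    Covers f c K S e r' :=
  ⟨h.1.trans hr, fun h' => (h.2 h').trans hr⟩

/-- The recorded best candidate is feasible, and its value is at least the recorded one. -/
structure Record (f : Finset E → ℝ) (c : E → ℕ) (K N : ℕ) (A : ℕ → Finset E) (σ : State E) :
    Prop where
  idx_lt : σ.idx 1 < N
  size_le : totalSize c (A (σ.idx 1) ∪ σ.reg 1) ≤ K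
  value_le : σ.num 6 ≤ f (A (σ.idx 1) ∪ σ.reg 1)

lemma runs_augmentBody {A : ℕ → Finset E} {σ : State E} {j : ℕ} {e : E}
    (hm : N + 11 ≤ m) (hm' : (N + 2) * K ≤ m) (hmono : Monotone f)
    (hc : ∀ e, 1 ≤ c e ∧ c e ≤ K) (hK : 1 ≤ K)
    (hA : ∀ j, totalSize c (A j) ≤ K) (hA' : ∀ j, N ≤ j → A j = ∅) (hj : j < N)
    (h : Stores c ε K M A σ) (hg : AtGrid ε j σ) (hr : Record f c K N A σ) :
    Runs f c stream m augmentBody (.item e) σ 8 0 fun σ' =>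
      Stores c ε K M A σ' ∧ AtGrid ε j σ' ∧ Record f c K N A σ' ∧ σ.num 6 ≤ σ'.num 6 ∧
        Covers f c K (A j) e (σ'.num 6) := by
  have ec (τ : State E) (hτ : τ.idx 0 = j) : curSet.eval τ = j + 2 := by simp [IExp.eval, hτ]
  -- `S` is the candidate of this round.
  set S : Finset E := if totalSize c (A j) + c e ≤ K then insert e (A j) else A j with hS
  have hSc : ∀ r, f S ≤ r → Covers f c K (A j) e r := by
    intro r hSr
    rw [hS] at hSr
    split_ifs at hSr with hb
    · exact ⟨(hmono (Finset.subset_insert _ _)).trans hSr, fun _ => hSr⟩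
    · exact ⟨hSr, fun h => absurd h hb⟩
  refine Runs.seq (T₁ := 2) (T₂ := 6) (k₁ := 0) (k₂ := 0) (Runs.mono
    (Q := fun σ₁ => σ₁ = σ.setNum 3 (f S)) ?_ ?_)
  · refine Runs.ite (fun hb => ?_) (fun hb => ?_)
    · rw [h.holds_fits hg.idx] at hb
      refine Runs.queryAdd (by simp [IExp.eval]; omega) ?_
      rw [ec _ hg.idx, h.sets, hS, if_pos hb]
      rfl
    · rw [h.holds_fits hg.idx] at hb
      refine Runs.query (by simp [IExp.eval]; omega) ?_
      rw [ec _ hg.idx, h.sets, hS, if_neg hb]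
      rfl
  rintro _ rfl
  have h₁ : Stores c ε K M A (σ.setNum 3 (f S)) := h.setNum (by omega) _
  have hb₁ : (Test.leNum (.cell (.const 6)) (.cell (.const 3))).holds c (.item e)
      (σ.setNum 3 (f S)) ↔ σ.num 6 ≤ f S := by
    simp [Test.holds, RExp.eval, IExp.eval]
  refine Runs.ite (fun hb => ?_) (fun hb => ?_)
  · rw [hb₁] at hb
    refine Runs.step (Runs.setNum (by simp [IExp.eval]; omega) ?_)
    refine Runs.step (Runs.setIdx (by omega) (by simp [IExp.eval, hg.idx]; omega) ?_)
    refine Runs.step (Runs.clear (by simp [IExp.eval]; omega) ?_)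
    have e1 (τ : State E) : (IExp.const 1).eval τ = 1 := rfl
    have e6 (τ : State E) : (IExp.const 6).eval τ = 6 := rfl
    have ev : (IExp.var 0).eval ((σ.setNum 3 (f S)).setNum 6 (f S)) = j := hg.idx
    have ex : (RExp.cell (.const 3)).eval c (.item e) (σ.setNum 3 (f S)) = f S := by
      simp [RExp.eval, IExp.eval]
    rw [e1, e6, ex, ev]
    set σ₂ := (((σ.setNum 3 (f S)).setNum 6 (f S)).setIdx 1 j).setReg 1 ∅ with hσ₂
    have h₂ : Stores c ε K M A σ₂ :=
      ((h₁.setNum (by omega) _).setIdx 1 j).setExtra (by simp)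
    have hg₂ : AtGrid ε j σ₂ := ⟨by simpa [hσ₂] using hg.idx, by simpa [hσ₂] using hg.pow⟩
    have i₂ : σ₂.idx 1 = j := by simp [hσ₂]
    have n₂ : σ₂.num 6 = f S := by simp [hσ₂]
    have r₂ : σ₂.reg 1 = ∅ := by simp [hσ₂]
    refine Runs.ite (fun hb' => ?_) (fun hb' => ?_)
    · rw [h₂.holds_fits hg₂.idx] at hb'
      rw [hS, if_pos hb'] at n₂ hb
      refine Runs.insert (by rw [e1]; omega) ?_ ?_
      · rw [e1, r₂]
        refine (h₂.stored_setReg_le (fun e => (hc e).1) hK hA hA' (by omega) ?_).trans hm'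
        simpa [totalSize] using (hc e).2
      · rw [e1, r₂]
        refine ⟨h₂.setExtra (by simp), ⟨hg₂.idx, hg₂.pow⟩, ⟨?_, ?_, ?_⟩, ?_, ?_⟩
        · simpa [i₂] using hj
        · simpa [i₂, Finset.union_comm (A j)] using (totalSize_insert_le c (A j) e).trans hb'
        · simpa [i₂, Finset.union_comm (A j)] using n₂.le
        · simpa [n₂] using hb
        · refine hSc _ ?_
          rw [hS, if_pos hb']
          simp [n₂]
    · rw [h₂.holds_fits hg₂.idx] at hb'
      refine Runs.skip ⟨h₂, hg₂, ⟨?_, ?_, ?_⟩, ?_, ?_⟩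
      · simpa [i₂] using hj
      · simpa [i₂, r₂] using hA j
      · rw [hS, if_neg hb'] at n₂
        simpa [i₂, r₂] using n₂.le
      · rw [n₂]; exact hb
      · exact hSc _ n₂.ge
  · rw [hb₁] at hb
    refine Runs.skip ⟨h₁, ⟨hg.idx, by simpa using hg.pow⟩, ⟨hr.1, hr.2, ?_⟩, ?_, ?_⟩
    · simpa using hr.3
    · simp
    · exact hSc _ (by simpa using (not_le.1 hb).le)

lemma runs_pass_augmentBody {A : ℕ → Finset E} {σ : State E} (hm : N + 11 ≤ m)
    (hm' : (N + 2) * K ≤ m) (hN : ∀ j < N, (1 + ε) ^ j ≤ (K : ℝ) * K)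
    (hN' : (K : ℝ) * K < (1 + ε) ^ N) (hmono : Monotone f)
    (hc : ∀ e, 1 ≤ c e ∧ c e ≤ K) (hK : 1 ≤ K)
    (hA : ∀ j, totalSize c (A j) ≤ K) (hA' : ∀ j, N ≤ j → A j = ∅)
    (h : Stores c ε K M A σ) (hr : Record f c K N A σ) :
    Runs f c stream m (.pass (gridLoop augmentBody)) .idle σ
      (stream.length * (N * 11 + 4) + 2) 1 fun σ' =>
        Stores c ε K M A σ' ∧ Record f c K N A σ' ∧
          ∀ e ∈ stream, ∀ i < N, Covers f c K (A i) e (σ'.num 6) := by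
  refine Runs.pass (T := N * 11 + 3) (P := fun l σ' => Stores c ε K M A σ' ∧
    Record f c K N A σ' ∧ ∀ e ∈ l, ∀ i < N, Covers f c K (A i) e (σ'.num 6)) ?_ ⟨h, hr, by simp⟩
  rintro l e l' - σ ⟨h, hr, hl⟩
  refine (Runs.gridLoop (T := 8) (P := fun j σ' => Stores c ε K M A σ' ∧
    Record f c K N A σ' ∧ (∀ x ∈ l, ∀ i < N, Covers f c K (A i) x (σ'.num 6)) ∧
      ∀ i < j, Covers f c K (A i) e (σ'.num 6)) hm hN hN'
    (fun j σ h => ⟨h.1.eps, h.1.cap⟩) ?_ ?_ ?_ ⟨h, hr, hl, by simp⟩).mono ?_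
  · rintro j σ x ⟨h, hr, h1, h2⟩
    exact ⟨h.setNum (by omega) x, ⟨hr.1, hr.2, by simpa using hr.3⟩, by simpa using h1,
      by simpa using h2⟩
  · rintro j σ v ⟨h, hr, h1, h2⟩
    exact ⟨h.setIdx 0 v, ⟨by simpa using hr.1, by simpa using hr.2, by simpa using hr.3⟩, h1, h2⟩
  · rintro j hj σ ⟨h, hr, h1, h2⟩ hg
    refine (runs_augmentBody hm hm' hmono hc hK hA hA' hj h hg hr).mono ?_
    rintro σ' ⟨h', hg', hr', hle, hcov⟩
    refine ⟨⟨h', hr', fun x hx i hi => (h1 x hx i hi).mono hle, fun i hi => ?_⟩, hg'⟩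
    rcases Nat.lt_succ_iff_lt_or_eq.1 hi with hi | rfl
    · exact (h2 i hi).mono hle
    · exact hcov
  · rintro σ' ⟨h, hr, h1, h2⟩
    refine ⟨h, hr, fun x hx => ?_⟩
    rcases List.mem_append.1 hx with hx | hx
    · exact h1 x hx
    · obtain rfl : x = e := by simpa using hx
      exact h2

/-! ### Correctness of the program -/

lemma runs_knapsackProg [Fintype E] [Nonempty E] (hm : N + 11 ≤ m) (hm' : (N + 2) * K ≤ m)
    (hN : ∀ j < N, (1 + ε) ^ j ≤ (K : ℝ) * K) (hN' : (K : ℝ) * K < (1 + ε) ^ N)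
    (hε : 0 < ε) (hε' : ε ≤ 1 / 2) (hK : 1 ≤ K)
    (h0 : ∀ S, 0 ≤ f S) (hmono : Monotone f) (hf : IsSubmodular f)
    (hc : ∀ e, 1 ≤ c e ∧ c e ≤ K) (hl : stream.Nodup) (hall : ∀ e, e ∈ stream) :
    Runs f c stream m knapsackProg .idle (State.init E ε K)
      (stream.length * (N * 20 + 12) + Fintype.card E + 12) 3 fun σ =>
        totalSize c (σ.reg 0) ≤ K ∧
        ∀ T : Finset E, totalSize c T ≤ K → (1 / 2 - ε) * f T ≤ f (σ.reg 0) := by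
  have e0 (τ : State E) : (IExp.const 0).eval τ = 0 := rfl
  have e1 (τ : State E) : (IExp.const 1).eval τ = 1 := rfl
  have e6 (τ : State E) : (IExp.const 6).eval τ = 6 := rfl
  have hNpos : 0 < N := by
    refine Nat.pos_of_ne_zero ?_
    rintro rfl
    have : (1 : ℝ) ≤ K := by exact_mod_cast hK
    simp only [pow_zero] at hN'
    nlinarith
  have hsum : stream.length * 4 + 2 + (stream.length * (N * 9 + 4) + 2 +
      (stream.length * (N * 11 + 4) + 2 + (Fintype.card E + 1 + (1 + 1)) + 1 + 1 + 1)) ≤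
      stream.length * (N * 20 + 12) + Fintype.card E + 12 := by
    ring_nf; omega
  refine Runs.of_le (Runs.seq (k₁ := 1) (k₂ := 2) ((runs_pass_maxBody (by omega)).mono ?_))
    hsum le_rfl
  rintro σ ⟨hM, hs0, hs1, hs7, hsr⟩
  refine Runs.seq (k₁ := 1) (k₂ := 1) ((runs_pass_sieveBody hm hm' hN hN'
    (fun e => (hc e).1) hK hl (M := σ.num 2)
    ⟨hs0, hs1, rfl, hsr 0, by simp [hsr], fun j => hsr _, by simp [hs7, totalSize]⟩).mono ?_)
  set M := σ.num 2
  set A := sieves f c K ε M N stream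
  intro σ₁ h₁
  refine Runs.step (Runs.setNum (by rw [e6]; omega) ?_)
  refine Runs.step (Runs.setIdx (by omega) (by rw [e0]; omega) ?_)
  refine Runs.step (Runs.clear (by rw [e1]; omega) ?_)
  rw [e0, e1, e6]
  have hA : ∀ j, totalSize c (A j) ≤ K := totalSize_sieves_le stream
  have hA' : ∀ j, N ≤ j → A j = ∅ := sieves_of_le stream
  refine Runs.seq (k₁ := 1) (k₂ := 0) ((runs_pass_augmentBody (A := A) (M := M) (ε := ε)
    hm hm' hN hN' hmono hc hK hA hA' ?_ ?_).mono ?_)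
  · exact ((h₁.setNum (by omega) _).setIdx _ _).setExtra (by simp)
  · refine ⟨by simpa using hNpos, by simpa using hA 0, ?_⟩
    simpa [RExp.eval, IExp.eval] using h0 (A 0)
  rintro σ₂ ⟨h₂, hr, hcov⟩
  have ev : (IExp.add (.var 1) (.const 2)).eval σ₂ = σ₂.idx 1 + 2 := rfl
  have hfin (S : Finset E) (hS : totalSize c S ≤ K) : (σ₂.setReg 0 S).stored m ≤ m :=
    (h₂.stored_setReg_le (fun e => (hc e).1) hK hA hA' (by omega) hS).trans hm'
  have hAr : totalSize c (A (σ₂.idx 1)) ≤ K := hA _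
  refine Runs.seq (k₁ := 0) (k₂ := 0) (Runs.union (by rw [e0]; omega) ?_ (Finset.card_le_univ _) ?_)
  · rw [e0, ev, h₂.out, h₂.sets, Finset.empty_union]
    exact hfin _ hAr
  rw [e0, ev, h₂.out, h₂.sets, Finset.empty_union]
  have hreg : (σ₂.setReg 0 (A (σ₂.idx 1))).reg 0 ∪ (σ₂.setReg 0 (A (σ₂.idx 1))).reg 1 =
      A (σ₂.idx 1) ∪ σ₂.reg 1 := by simp
  have hset (S : Finset E) : (σ₂.setReg 0 (A (σ₂.idx 1))).setReg 0 S = σ₂.setReg 0 S := by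
    simp [State.setReg]
  refine Runs.union (by rw [e0]; omega) ?_ ?_ ?_
  · rw [e0, e1, hreg, hset]
    exact hfin _ hr.size_le
  · rw [e1]
    simpa using h₂.extra
  rw [e0, e1, hreg, hset, setReg_reg, if_pos rfl]
  refine ⟨hr.size_le, fun T hT => le_trans ?_ hr.value_le⟩
  obtain ⟨j, hj, h⟩ := exists_threshold_half_le h0 hmono hf hc hl hall hε hε' hK hN' hM hT
  have hAj : A j = sieve f c K (threshold ε K M j) stream := by simp [A, sieves, hj]
  rw [← hAj] at h
  rcases h with h | ⟨e, h1, h2⟩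
  · obtain ⟨e⟩ := ‹Nonempty E›
    exact h.trans (hcov e (hall e) j hj).1
  · exact h2.trans ((hcov e (hall e) j hj).2 h1)

end Program

end StreamRAM

/-! ### Resource bounds -/

theorem theorem2 :
    ∃ (p : StreamRAM.Prog) (C : ℝ), ∀ (ε : ℝ), 0 < ε → ε ≤ 1 / 2 → ∀ (K : ℕ), 1 ≤ K →
      ∀ (E : Type*) [Fintype E] [DecidableEq E] [Nonempty E]
        (f : Finset E → ℝ) (c : E → ℕ) (stream : List E),
        (∀ S, 0 ≤ f S) → Monotone f → IsSubmodular f →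
        (∀ e, 1 ≤ c e ∧ c e ≤ K) →
        stream.Nodup → (∀ e, e ∈ stream) →
        ∃ (space time passes : ℕ) (σ : StreamRAM.State E),
          StreamRAM.Exec f c stream space p .idle (StreamRAM.State.init E ε K) σ time passes ∧
          totalSize c (σ.reg 0) ≤ K ∧
          (∀ T : Finset E, totalSize c T ≤ K → (1 / 2 - ε) * f T ≤ f (σ.reg 0)) ∧
          (space : ℝ) ≤ C * (K * ε⁻¹ ^ 7 * Real.log (K + 1) ^ 2) ∧
          (passes : ℝ) ≤ C * ε⁻¹ ∧
          (time : ℝ) ≤ C * (Fintype.card E * ε⁻¹ ^ 8 * Real.log (K + 1) ^ 2) := by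
  refine ⟨StreamRAM.knapsackProg, 210, ?_⟩
  intro ε hε hε' K hK E _ _ _ f c stream h0 hmono hf hc hl hall
  obtain ⟨N, hN, hN', hNle⟩ := exists_grid_length hε hε' hK
  have hKn : N + 11 ≤ (N + 11) * K := Nat.le_mul_of_pos_right _ hK
  obtain ⟨σ, t, k, hex, ht, hk, h1, h2⟩ := StreamRAM.runs_knapsackProg (m := (N + 11) * K) hKn
    (Nat.mul_le_mul_right _ (by omega)) hN hN' hε hε' hK h0 hmono hf hc hl hall
  have hlen : stream.length = Fintype.card E := by
    rw [← List.toFinset_card_of_nodup hl, ← Finset.card_univ]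
    congr 1
    ext e
    simp [hall]
  have hE : (1 : ℝ) ≤ Fintype.card E := by exact_mod_cast Fintype.card_pos
  have hK' : (1 : ℝ) ≤ K := by exact_mod_cast hK
  have hi : 2 ≤ ε⁻¹ := by
    rw [le_inv_comm₀ two_pos hε]
    linarith
  have hlog : 1 / 2 ≤ Real.log (K + 1) :=
    le_trans (by linarith [Real.log_two_gt_d9]) (Real.log_le_log two_pos (by linarith))
  -- All costs are multiples of `X`, which bounds the number of thresholds up to a constant.
  set X := ε⁻¹ * Real.log (K + 1) with hX
  have hX1 : 1 ≤ X := by nlinarith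
  have hX2 : X ≤ 2 * (ε⁻¹ * Real.log (K + 1) ^ 2) := by
    rw [hX]; nlinarith [mul_nonneg (by linarith : 0 ≤ ε⁻¹) (by linarith : 0 ≤ Real.log (K + 1))]
  have hpow (n : ℕ) (hn : n ≠ 0) : X ≤ 2 * (ε⁻¹ ^ n * Real.log (K + 1) ^ 2) := by
    refine hX2.trans ?_
    gcongr
    exact le_self_pow₀ (by linarith) hn
  refine ⟨(N + 11) * K, t, k, σ, hex, h1, h2, ?_, ?_, ?_⟩
  · have h3 : ((N + 11 : ℕ) : ℝ) ≤ 15 * X := by push_cast; linarith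
    have h4 := hpow 7 (by norm_num)
    calc (((N + 11) * K : ℕ) : ℝ) = K * ((N + 11 : ℕ) : ℝ) := by push_cast; ring
      _ ≤ K * (210 * (ε⁻¹ ^ 7 * Real.log (K + 1) ^ 2)) := by gcongr; linarith
      _ = _ := by ring
  · have h3 : (k : ℝ) ≤ 3 := by exact_mod_cast hk
    linarith
  · have h3 : (t : ℝ) ≤ Fintype.card E * (N * 20 + 12) + Fintype.card E + 12 := by
      rw [hlen] at ht
      exact_mod_cast ht
    have h4 := hpow 8 (by norm_num)
    calc (t : ℝ) ≤ Fintype.card E * (N * 20 + 25) := by linarith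
      _ ≤ Fintype.card E * (210 * (ε⁻¹ ^ 8 * Real.log (K + 1) ^ 2)) := by gcongr; linarith
      _ = _ := by ring
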